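/- There is an absolute constant $C>0$ such that the following holds. Let $G=(V,E)$ be any finite undirected unweighted (simple) graph with $n=|V|$ vertices, let $0<\varepsilon<1/2$, and let $k$ be an integer with $k\ge 16^{1/\varepsilon}$. Then there is a random subgraph $H\subseteq G$ on the vertex set $V$ (a probability distribution on subgraphs of $G$) such that every outcome $H$ is an $(8k^{\varepsilon},\,64^{1/\varepsilon}k)$-spanner of $G$, that is, $$\mathrm{dist}_H(u,v)\;\le\; 8k^{\varepsilon}\cdot \mathrm{dist}_G(u,v)+64^{1/\varepsilon}\cdot k$$ for all $u,v\in V$ that are connected in $G$ (in particular such $u,v$ are connected in $H$), and the expected number of edges satisfies $$\mathbb{E}\,|E(H)|\;\le\; C\left(64^{1/\varepsilon}\cdot k\cdot n^{1+1/k}+64^{2/\varepsilon}\cdot k^{2}\cdot n\right).$$ -/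

import Mathlib

open scoped ENNReal

/-- `H` is an `(α, β)`-spanner of the unweighted graph `G`: a subgraph of `G` on the same vertex
set such that any two vertices at finite distance in `G` are at finite distance in `H`, with
`dist_H(u, v) ≤ α * dist_G(u, v) + β`. (Pairs at infinite distance in `G` impose no condition.) -/
def IsAddMulSpanner {V : Type*} (G H : SimpleGraph V) (α β : ℝ) : Prop :=
  H ≤ G ∧ ∀ u v : V, G.Reachable u v →
    H.Reachable u v ∧ (H.dist u v : ℝ) ≤ α * (G.dist u v : ℝ) + β

/-- The expected number of edges of a random graph on the vertex set `V` with distribution `μ`. -/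
noncomputable def expectedSize {V : Type*} (μ : PMF (SimpleGraph V)) : ℝ≥0∞ :=
  ∑' H : SimpleGraph V, μ H * (H.edgeSet.encard : ℝ≥0∞)

/-! No randomness is needed. Write n = |V| and x = n^(1/k), and use scales i ≤ L of length (20t)^i,
with centres S_0 = V, S_1, ... and growth factors Δ_i = x^((t+1)^i). Join centres of S_i at distance
O((20t)^i) in an auxiliary graph. At centres whose t-ball there has at most Δ_i^t members, region
growing spans all auxiliary edges with stretch 2t, using Δ_i|S_i| of them. A maximal packing of the
denser balls supplies S_{i+1}, with |S_{i+1}| Δ_i^t ≤ |S_i| (`exists_supercluster`). Hence Δ_i|S_i|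
≤ nx persists, and S_{L+1} is empty once (t+1)^(L+1) > k.

For the stretch (`Within.stretch_of_hierarchy`), cut a path into pieces of length (20t)^i. A piece
with both ends near S_i is either stretched by at most α or has both ends near S_{i+1}. A bad piece
of the next scale contains a bad piece of this one, so its own ends are near S_{i+1} as well. Beyond
the top scale no centres are left, so no piece is bad there. Rounding up to whole top-scale pieces
costs the additive term. -/

/-- `u` and `v` are joined in `G` by a walk of length at most `m`. -/
def SimpleGraph.Within {V : Type*} (G : SimpleGraph V) (u v : V) (m : ℕ) : Prop :=
  ∃ p : G.Walk u v, p.length ≤ m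

namespace SimpleGraph

/-! ### Walks of bounded length. -/

section Within

variable {V : Type*} {G H : SimpleGraph V} {u v w : V} {m n : ℕ}

theorem Within.refl (G : SimpleGraph V) (u : V) (m : ℕ) : G.Within u u m :=
  ⟨Walk.nil, Nat.zero_le _⟩

theorem Within.symm (h : G.Within u v m) : G.Within v u m := by
  obtain ⟨p, hp⟩ := h
  exact ⟨p.reverse, by simpa using hp⟩

theorem Within.trans (h : G.Within u v m) (h' : G.Within v w n) : G.Within u w (m + n) := by
  obtain ⟨p, hp⟩ := h
  obtain ⟨q, hq⟩ := h'
  exact ⟨p.append q, by rw [Walk.length_append]; omega⟩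

theorem Within.mono (h : G.Within u v m) (hmn : m ≤ n) : G.Within u v n := by
  obtain ⟨p, hp⟩ := h
  exact ⟨p, hp.trans hmn⟩

theorem Within.of_le (h : G.Within u v m) (hGH : G ≤ H) : H.Within u v m := by
  obtain ⟨p, hp⟩ := h
  exact ⟨p.mapLe hGH, by simpa using hp⟩

theorem Adj.within (h : G.Adj u v) : G.Within u v 1 :=
  ⟨h.toWalk, by simp⟩

theorem within_zero : G.Within u v 0 ↔ u = v := by
  constructor
  · rintro ⟨p, hp⟩
    exact Walk.eq_of_length_eq_zero (Nat.le_zero.mp hp)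
  · rintro rfl
    exact Within.refl G u 0

theorem Within.eq_or_adj (h : G.Within u v (m + 1)) :
    u = v ∨ ∃ w, G.Adj u w ∧ G.Within w v m := by
  obtain ⟨p, hp⟩ := h
  cases p with
  | nil => exact Or.inl rfl
  | cons h q => exact Or.inr ⟨_, h, q, by simpa using hp⟩

theorem Within.exists_between : ∀ {m : ℕ} {u : V}, G.Within u v (m + n) →
    ∃ w, G.Within u w m ∧ G.Within w v n := by
  intro m
  induction m with
  | zero => exact fun {u} h => ⟨u, Within.refl G u 0, by simpa using h⟩
  | succ m ih =>
    intro u h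
    rw [Nat.add_right_comm] at h
    rcases h.eq_or_adj with rfl | ⟨w, hw, h'⟩
    · exact ⟨u, Within.refl G u _, Within.refl G u _⟩
    · obtain ⟨z, hz, hz'⟩ := ih h'
      exact ⟨z, (hw.within.trans hz).mono (by omega), hz'⟩

/-- A walk transfers to `H` with stretch `D` if each of its edges does. -/
theorem Within.stretch {D : ℕ} (hGH : ∀ a b, G.Adj a b → H.Within a b D) :
    ∀ {m : ℕ} {u : V}, G.Within u v m → H.Within u v (m * D) := by
  intro m
  induction m with
  | zero =>
    intro u h
    rw [within_zero.mp h]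
    exact Within.refl H _ _
  | succ m ih =>
    intro u h
    rcases h.eq_or_adj with rfl | ⟨w, hw, h'⟩
    · exact Within.refl H _ _
    · exact ((hGH u w hw).trans (ih h')).mono (by rw [Nat.succ_mul, add_comm])

/-- Cutting a walk of length `b * a` into `b` pieces of length `a`: if it is not stretched to
length `b * c` in `H`, then some piece is not stretched to length `c`. -/
theorem Within.blocks (a c : ℕ) : ∀ (b : ℕ) {u : V}, G.Within u v (b * a) →
    H.Within u v (b * c) ∨ ∃ p q, G.Within u p (b * a) ∧ G.Within p q a ∧
      ¬ H.Within p q c ∧ G.Within q v (b * a) := by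
  intro b
  induction b with
  | zero =>
    intro u h
    rw [Nat.zero_mul, within_zero] at h
    subst h
    exact Or.inl (Within.refl H u _)
  | succ b ih =>
    intro u h
    rw [Nat.succ_mul, add_comm] at h
    obtain ⟨w, hw, hv⟩ := h.exists_between
    have hle : b * a ≤ (b + 1) * a := Nat.mul_le_mul_right _ (Nat.le_succ b)
    by_cases huw : H.Within u w c
    · rcases ih hv with h1 | ⟨p, q, hp, hpq, hn, hq⟩
      · exact Or.inl ((huw.trans h1).mono (by rw [Nat.succ_mul, add_comm]))
      · exact Or.inr ⟨p, q, (hw.trans hp).mono (by rw [Nat.succ_mul, add_comm]), hpq, hn,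
          hq.mono hle⟩
    · exact Or.inr ⟨u, w, Within.refl G u _, hw, huw, hv.mono hle⟩

end Within

/-! ### Auxiliary graphs and their realization by walks. -/

section Auxiliary

variable {V : Type*}

/-- Edges of an auxiliary graph that join vertices at distance at most `D` in `G` can be replaced
by walks in `G`. -/
theorem exists_realization (G : SimpleGraph V) (D : ℕ) (E : Finset (Sym2 V))
    (hE : ∀ a b, s(a, b) ∈ E → G.Within a b D) :
    ∃ E' : Finset (Sym2 V), (E' : Set (Sym2 V)) ⊆ G.edgeSet ∧ E'.card ≤ E.card * D ∧
      ∀ u v m, (fromEdgeSet (E : Set (Sym2 V))).Within u v m →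
        (fromEdgeSet (E' : Set (Sym2 V))).Within u v (m * D) := by
  classical
  have key : ∀ e : Sym2 V, ∃ P : Finset (Sym2 V), e ∈ E →
      (P : Set (Sym2 V)) ⊆ G.edgeSet ∧ P.card ≤ D ∧
      ∀ a b, e = s(a, b) → (fromEdgeSet (P : Set (Sym2 V))).Within a b D := by
    intro e
    by_cases he : e ∈ E
    · induction e with
      | _ a b =>
      obtain ⟨p, hp⟩ := hE a b he
      have hw : (fromEdgeSet ((p.edges.toFinset : Finset (Sym2 V)) : Set (Sym2 V))).Within
          a b D := by
        refine ⟨p.transfer _ fun e' he' => ?_, by simpa using hp⟩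
        rw [edgeSet_fromEdgeSet]
        exact ⟨by simpa using he', G.not_isDiag_of_mem_edgeSet (p.edges_subset_edgeSet he')⟩
      refine ⟨p.edges.toFinset, fun _ => ⟨fun e' he' => ?_, ?_, ?_⟩⟩
      · exact p.edges_subset_edgeSet (by simpa using he')
      · exact (List.toFinset_card_le _).trans (by simpa using hp)
      · intro a' b' hab
        rcases Sym2.eq_iff.mp hab with ⟨rfl, rfl⟩ | ⟨rfl, rfl⟩
        · exact hw
        · exact hw.symm
    · exact ⟨∅, fun h => absurd h he⟩
  choose P hP using key
  refine ⟨E.biUnion P, ?_, Finset.card_biUnion_le_card_mul _ _ _ fun e he => (hP e he).2.1, ?_⟩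
  · intro e he
    simp only [Finset.coe_biUnion, Set.mem_iUnion] at he
    obtain ⟨e', he', h⟩ := he
    exact (hP e' he').1 h
  · intro u v m h
    refine h.stretch fun a b hab => ?_
    rw [fromEdgeSet_adj] at hab
    exact ((hP _ hab.1).2.2 a b rfl).of_le
      (fromEdgeSet_mono (Finset.coe_subset.mpr (Finset.subset_biUnion_of_mem P hab.1)))

/-- The graph `G` with all edges removed that leave `R`. -/
def restrict (G : SimpleGraph V) (R : Finset V) : SimpleGraph V where
  Adj a b := G.Adj a b ∧ a ∈ R ∧ b ∈ R
  symm := ⟨fun _ _ h => ⟨h.1.symm, h.2.2, h.2.1⟩⟩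
  loopless := ⟨fun _ h => h.1.ne rfl⟩

theorem restrict_le (G : SimpleGraph V) (R : Finset V) : G.restrict R ≤ G :=
  fun _ _ h => h.1

/-- Vertices outside `R` stay in the restricted graph but are isolated there. -/
theorem Within.mem_of_restrict {G : SimpleGraph V} {R : Finset V} {c : V} (hc : c ∈ R) {m : ℕ}
    {u : V} (h : (G.restrict R).Within u c m) : u ∈ R := by
  cases m with
  | zero => exact within_zero.mp h ▸ hc
  | succ m =>
    rcases h.eq_or_adj with rfl | ⟨w, hw, -⟩
    · exact hc
    · exact hw.2.1

/-- The graph on `S` whose edges are the pairs at distance at most `D` in `G`. -/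
def proximity (G : SimpleGraph V) (S : Finset V) (D : ℕ) : SimpleGraph V where
  Adj a b := a ≠ b ∧ a ∈ S ∧ b ∈ S ∧ G.Within a b D
  symm := ⟨fun _ _ h => ⟨h.1.symm, h.2.2.1, h.2.1, h.2.2.2.symm⟩⟩
  loopless := ⟨fun _ h => h.1 rfl⟩

end Auxiliary

/-! ### Breadth-first forests, region growing and ball packings. -/

section Finite

variable {V : Type*} [Fintype V]

open Classical in
/-- The vertices joined to the set `A` by a walk of length at most `m`. -/
noncomputable def nearby (G : SimpleGraph V) (A : Set V) (m : ℕ) : Finset V :=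
  {u | ∃ s ∈ A, G.Within u s m}

theorem mem_nearby {G : SimpleGraph V} {A : Set V} {m : ℕ} {u : V} :
    u ∈ G.nearby A m ↔ ∃ s ∈ A, G.Within u s m := by
  simp [nearby]

theorem mem_nearby_singleton {G : SimpleGraph V} {c : V} {m : ℕ} {u : V} :
    u ∈ G.nearby {c} m ↔ G.Within u c m := by
  simp [nearby]

/-- A breadth-first forest rooted at `A`, cut off at depth `M`. -/
theorem exists_bfs_forest (G : SimpleGraph V) (A : Set V) (M : ℕ) :
    ∃ E : Finset (Sym2 V), (E : Set (Sym2 V)) ⊆ G.edgeSet ∧ E.card ≤ (G.nearby A M).card ∧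
      ∀ m ≤ M, ∀ u, (∃ s ∈ A, G.Within u s m) →
        ∃ s ∈ A, (fromEdgeSet (E : Set (Sym2 V))).Within u s m := by
  classical
  -- The parent of `u` is the first step of a shortest walk to `A`, so a single choice serves every
  -- bound `m`.
  have key : ∀ u, u ∉ A → (∃ m, ∃ s ∈ A, G.Within u s m) → ∃ w, G.Adj u w ∧
      ∀ m, (∃ s ∈ A, G.Within u s m) → ∃ m', m = m' + 1 ∧ ∃ s ∈ A, G.Within w s m' := by
    intro u hu hex
    obtain ⟨s, hs, hus⟩ := Nat.find_spec hex
    cases hm : Nat.find hex with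
    | zero =>
      rw [hm, within_zero] at hus
      exact absurd (hus ▸ hs) hu
    | succ j =>
      rw [hm] at hus
      rcases hus.eq_or_adj with rfl | ⟨w, hw, hws⟩
      · exact absurd hs hu
      · refine ⟨w, hw, fun m hmm => ?_⟩
        have hle := Nat.find_min' hex hmm
        exact ⟨m - 1, by omega, s, hs, hws.mono (by omega)⟩
  have key' : ∀ u, ∃ w, u ∉ A → (∃ m, ∃ s ∈ A, G.Within u s m) → G.Adj u w ∧
      ∀ m, (∃ s ∈ A, G.Within u s m) → ∃ m', m = m' + 1 ∧ ∃ s ∈ A, G.Within w s m' := by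
    intro u
    by_cases h : u ∉ A ∧ (∃ m, ∃ s ∈ A, G.Within u s m)
    · obtain ⟨w, hw⟩ := key u h.1 h.2
      exact ⟨w, fun _ _ => hw⟩
    · exact ⟨u, fun h1 h2 => absurd ⟨h1, h2⟩ h⟩
  choose f hf using key'
  refine ⟨((G.nearby A M).filter (· ∉ A)).image fun u => s(u, f u), ?_, ?_, ?_⟩
  · intro e he
    simp only [Finset.coe_image, Set.mem_image, Finset.mem_coe, Finset.mem_filter,
      mem_nearby] at he
    obtain ⟨u, ⟨hu, huA⟩, rfl⟩ := he
    exact (hf u huA ⟨M, hu⟩).1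
  · exact Finset.card_image_le.trans (Finset.card_filter_le _ _)
  · intro m
    induction m with
    | zero =>
      rintro - u ⟨s, hs, hus⟩
      rw [within_zero] at hus
      exact ⟨s, hs, within_zero.mpr hus⟩
    | succ m ih =>
      intro hm u hu
      by_cases huA : u ∈ A
      · exact ⟨u, huA, Within.refl _ u _⟩
      · obtain ⟨hadj, hstep⟩ := hf u huA ⟨_, hu⟩
        obtain ⟨m', hm', hw⟩ := hstep _ hu
        obtain rfl : m = m' := by omega
        obtain ⟨s, hs, hws⟩ := ih (by omega) _ hw
        refine ⟨s, hs, ?_⟩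
        obtain ⟨s0, hs0, hus0⟩ := hu
        have hE : (fromEdgeSet ((((G.nearby A M).filter (· ∉ A)).image
            fun u => s(u, f u) : Finset (Sym2 V)) : Set (Sym2 V))).Adj u (f u) := by
          rw [fromEdgeSet_adj]
          refine ⟨?_, hadj.ne⟩
          exact Finset.mem_coe.mpr (Finset.mem_image_of_mem (fun u => s(u, f u))
            (Finset.mem_filter.mpr ⟨mem_nearby.mpr ⟨s0, hs0, hus0.mono hm⟩, huA⟩))
        exact (hE.within.trans hws).mono (by omega)

/-- A ball of radius `t` with at most `Δ ^ t` vertices stops growing by the factor `Δ` at some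
smaller radius. -/
theorem exists_slow_growth (G : SimpleGraph V) (c : V) {t : ℕ} (ht : 0 < t) {Δ : ℝ} (hΔ : 1 ≤ Δ)
    (hpoor : ((G.nearby {c} t).card : ℝ) ≤ Δ ^ t) :
    ∃ j < t, ((G.nearby {c} (j + 1)).card : ℝ) ≤ Δ * (G.nearby {c} j).card := by
  by_contra! hgrow
  have hpos : 0 < Δ := by linarith
  have hle : ∀ j ≤ t, Δ ^ j ≤ ((G.nearby {c} j).card : ℝ) := by
    intro j
    induction j with
    | zero =>
      intro _
      have : 0 < (G.nearby {c} 0).card :=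
        Finset.card_pos.mpr ⟨c, mem_nearby_singleton.mpr (Within.refl G c 0)⟩
      rw [pow_zero]
      exact_mod_cast this
    | succ j ih =>
      intro hj
      calc Δ ^ (j + 1) = Δ * Δ ^ j := pow_succ' _ _
        _ ≤ Δ * (G.nearby {c} j).card := by gcongr; exact ih (by omega)
        _ ≤ _ := (hgrow j (by omega)).le
  -- Strict growth in the last step alone pushes the `t`-ball above `Δ ^ t`.
  obtain ⟨j, rfl⟩ : ∃ j, t = j + 1 := ⟨t - 1, by omega⟩
  have h1 := hgrow j (by omega)
  have h2 := hle j (by omega)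
  have h3 : Δ ^ (j + 1) ≤ Δ * (G.nearby {c} j).card := by
    rw [pow_succ']
    gcongr
  linarith

/-- Region growing: with `Δ * |R|` edges, all edges of `G` at the vertices of `R` with sparse
`t`-balls are spanned with stretch `2 * t`. -/
theorem exists_region_growing (G : SimpleGraph V) {t : ℕ} (ht : 0 < t) {Δ : ℝ} (hΔ : 1 ≤ Δ) :
    ∀ R : Finset V, ∃ E : Finset (Sym2 V), (E : Set (Sym2 V)) ⊆ G.edgeSet ∧
      (E.card : ℝ) ≤ Δ * R.card ∧
      ∀ c ∈ R, ((G.nearby {c} t).card : ℝ) ≤ Δ ^ t → ∀ c' ∈ R, G.Adj c c' →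
        (fromEdgeSet (E : Set (Sym2 V))).Within c c' (2 * t) := by
  classical
  intro R
  induction R using Finset.strongInduction with
  | H R ih =>
  by_cases hR : ∃ c ∈ R, ((G.nearby {c} t).card : ℝ) ≤ Δ ^ t
  · obtain ⟨c, hcR, hc⟩ := hR
    have hsub : (G.restrict R).nearby {c} t ⊆ G.nearby {c} t := fun u hu =>
      mem_nearby_singleton.mpr ((mem_nearby_singleton.mp hu).of_le (G.restrict_le R))
    obtain ⟨j, hjt, hj⟩ := (G.restrict R).exists_slow_growth c ht hΔ
      (le_trans (by exact_mod_cast Finset.card_le_card hsub) hc)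
    set B := (G.restrict R).nearby {c} j with hB
    have hBR : B ⊆ R := fun u hu => Within.mem_of_restrict hcR (mem_nearby_singleton.mp hu)
    have hcB : c ∈ B := mem_nearby_singleton.mpr (Within.refl _ c j)
    obtain ⟨E₀, hE₀, hcard₀, htree⟩ := (G.restrict R).exists_bfs_forest {c} (j + 1)
    obtain ⟨E₁, hE₁, hcard₁, hspan⟩ := ih (R \ B)
      (Finset.sdiff_ssubset hBR ⟨c, hcB⟩)
    -- The tree reaches one step beyond `B`, so edges leaving `B` are spanned too and `B` can be
    -- discarded. Slow growth lets the vertices of `B` pay for the tree, `Δ` edges each.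
    have hmem : ∀ x ∈ B, ∀ y ∈ R, G.Adj x y →
        (fromEdgeSet ((E₀ ∪ E₁ : Finset (Sym2 V)) : Set (Sym2 V))).Within x y (2 * t) := by
      intro x hx y hy hxy
      have hxc : (G.restrict R).Within x c j := mem_nearby_singleton.mp hx
      have hyx : (G.restrict R).Adj y x := ⟨hxy.symm, hy, hBR hx⟩
      obtain ⟨_, rfl, h1⟩ := htree (j + 1) le_rfl x ⟨c, rfl, hxc.mono (Nat.le_succ j)⟩
      obtain ⟨_, rfl, h2⟩ := htree (j + 1) le_rfl y
        ⟨_, rfl, (hyx.within.trans hxc).mono (by omega)⟩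
      exact ((h1.trans h2.symm).mono (by omega)).of_le
        (fromEdgeSet_mono (Finset.coe_subset.mpr Finset.subset_union_left))
    refine ⟨E₀ ∪ E₁, ?_, ?_, ?_⟩
    · rw [Finset.coe_union]
      exact Set.union_subset (hE₀.trans (edgeSet_mono (G.restrict_le R))) hE₁
    · have h1 : ((E₀ ∪ E₁).card : ℝ) ≤ E₀.card + E₁.card := by
        exact_mod_cast Finset.card_union_le _ _
      have h2 : (E₀.card : ℝ) ≤ ((G.restrict R).nearby {c} (j + 1)).card := by
        exact_mod_cast hcard₀
      have h3 : ((R \ B).card : ℝ) + B.card = R.card := by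
        exact_mod_cast Finset.card_sdiff_add_card_eq_card hBR
      rw [← h3, mul_add]
      linarith
    · intro x hx hpoor y hy hxy
      by_cases hxB : x ∈ B
      · exact hmem x hxB y hy hxy
      by_cases hyB : y ∈ B
      · exact (hmem y hyB x hx hxy.symm).symm
      · exact (hspan x (Finset.mem_sdiff.mpr ⟨hx, hxB⟩) hpoor y
          (Finset.mem_sdiff.mpr ⟨hy, hyB⟩) hxy).of_le
          (fromEdgeSet_mono (Finset.coe_subset.mpr Finset.subset_union_right))
  · push Not at hR
    refine ⟨∅, by simp, ?_, fun c hc hpoor => absurd hpoor (not_le.mpr (hR c hc))⟩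
    simp only [Finset.card_empty, Nat.cast_zero]
    positivity

/-- A maximal packing of dense `t`-balls. -/
theorem exists_dense_packing (G : SimpleGraph V) (S : Finset V)
    (hGS : ∀ a b, G.Adj a b → a ∈ S) (t : ℕ) (Δ : ℝ) :
    ∃ S' : Finset V, (S'.card : ℝ) * Δ ^ t ≤ S.card ∧
      ((S.card : ℝ) ≤ Δ ^ t → S' = ∅) ∧
      ∀ c ∈ S, Δ ^ t < ((G.nearby {c} t).card : ℝ) → ∃ s ∈ S', G.Within c s (2 * t) := by
  classical
  have hball : ∀ c ∈ S, G.nearby {c} t ⊆ S := by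
    intro c hc u hu
    rw [mem_nearby_singleton] at hu
    cases t with
    | zero => exact within_zero.mp hu ▸ hc
    | succ m =>
      rcases hu.eq_or_adj with rfl | ⟨w, hw, -⟩
      · exact hc
      · exact hGS _ _ hw
  let rich : Finset V := S.filter fun c => Δ ^ t < ((G.nearby {c} t).card : ℝ)
  let packings : Finset (Finset V) :=
    rich.powerset.filter fun T => (T : Set V).PairwiseDisjoint fun c => G.nearby {c} t
  obtain ⟨S', hS', hmax⟩ := packings.exists_max_image Finset.card
    ⟨∅, by simp [packings]⟩
  obtain ⟨hsub, hdisj⟩ : S' ⊆ rich ∧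
      (S' : Set V).PairwiseDisjoint fun c => G.nearby {c} t := by
    simpa [packings] using hS'
  refine ⟨S', ?_, ?_, ?_⟩
  · have h1 : (S'.biUnion fun c => G.nearby {c} t).card ≤ S.card :=
      Finset.card_le_card (Finset.biUnion_subset.mpr fun c hc =>
        hball c (Finset.mem_filter.mp (hsub hc)).1)
    rw [Finset.card_biUnion hdisj] at h1
    have h2 : S'.card • Δ ^ t ≤ ∑ c ∈ S', ((G.nearby {c} t).card : ℝ) :=
      Finset.card_nsmul_le_sum _ _ _ fun c hc => (Finset.mem_filter.mp (hsub hc)).2.le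
    rw [nsmul_eq_mul] at h2
    exact h2.trans (by exact_mod_cast h1)
  -- The packing count alone would still allow one centre when `S.card = Δ ^ t`; the strict
  -- inequality defining `rich` excludes it.
  · intro hS
    refine Finset.eq_empty_of_forall_notMem fun c hc => ?_
    obtain ⟨hcS, hlt⟩ := Finset.mem_filter.mp (hsub hc)
    have : ((G.nearby {c} t).card : ℝ) ≤ S.card := by
      exact_mod_cast Finset.card_le_card (hball c hcS)
    linarith
  · intro c hcS hc
    by_contra! hfar
    have hcS' : c ∉ S' := fun h => hfar c h (Within.refl G c _)
    have hins : insert c S' ∈ packings := by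
      refine Finset.mem_filter.mpr ⟨Finset.mem_powerset.mpr
        (Finset.insert_subset (Finset.mem_filter.mpr ⟨hcS, hc⟩) hsub), ?_⟩
      rw [Finset.coe_insert]
      refine hdisj.insert fun s hs _ => ?_
      rw [Finset.disjoint_left]
      intro u hu hu'
      rw [mem_nearby_singleton] at hu hu'
      exact hfar s hs ((hu.symm.trans hu').mono (by omega))
    have := hmax _ hins
    rw [Finset.card_insert_of_notMem hcS'] at this
    omega

/-- One round of superclustering: a few edges connect each centre in `S` to all centres in `S`
near it, unless it is close to one of the much fewer centres in `S'`. -/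
theorem exists_supercluster (G : SimpleGraph V) {t : ℕ} (ht : 0 < t) (S : Finset V) (D : ℕ)
    {Δ : ℝ} (hΔ : 1 ≤ Δ) :
    ∃ (S' : Finset V) (E : Finset (Sym2 V)), (E : Set (Sym2 V)) ⊆ G.edgeSet ∧
      (E.card : ℝ) ≤ Δ * S.card * D ∧ (S'.card : ℝ) * Δ ^ t ≤ S.card ∧
      ((S.card : ℝ) ≤ Δ ^ t → S' = ∅) ∧
      ∀ c ∈ S, (∀ c' ∈ S, G.Within c c' D →
          (fromEdgeSet (E : Set (Sym2 V))).Within c c' (2 * t * D)) ∨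
        ∃ s ∈ S', G.Within c s (2 * t * D) := by
  obtain ⟨S', hcard, hempty, hrich⟩ := (G.proximity S D).exists_dense_packing S
    (fun a b h => h.2.1) t Δ
  obtain ⟨E₀, hE₀, hcard₀, hpoor⟩ := (G.proximity S D).exists_region_growing ht hΔ S
  obtain ⟨E, hE, hcardE, hreal⟩ := G.exists_realization D E₀ fun a b hab => (hE₀ hab).2.2.2
  refine ⟨S', E, hE, ?_, hcard, hempty, fun c hc => ?_⟩
  · calc (E.card : ℝ) ≤ E₀.card * D := by exact_mod_cast hcardE
      _ ≤ _ := by gcongr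
  · rcases le_or_gt (((G.proximity S D).nearby {c} t).card : ℝ) (Δ ^ t) with h | h
    · refine Or.inl fun c' hc' hcc' => ?_
      by_cases hne : c = c'
      · exact hne ▸ Within.refl _ _ _
      · exact hreal _ _ _ (hpoor c hc h c' hc' ⟨hne, hc, hc', hcc'⟩)
    · obtain ⟨s, hs, hcs⟩ := hrich c hc h
      exact Or.inr ⟨s, hs, Within.stretch (G := G.proximity S D) (fun _ _ hab => hab.2.2.2) hcs⟩

end Finite

end SimpleGraph

namespace SimpleGraph

/-! ### Stretch across the scales. -/

section Hierarchy

variable {V : Type*}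

/-- The distance within which, at scale `i`, the vertices of a badly stretched path have a centre
of level `i`. -/
def coverRadius (t : ℕ) : ℕ → ℕ
  | 0 => 0
  | i + 1 => (20 * t) ^ (i + 1) +
      (coverRadius t i + 2 * t * ((20 * t) ^ i + 2 * coverRadius t i))

/-- Cover radii stay proportional to the scale: with a = (20t)^i, the recursion gives at most 138ta
+ 7a on the left, and the target is 140ta. -/
theorem five_mul_coverRadius_le {t : ℕ} (ht : 6 ≤ t) (i : ℕ) :
    5 * coverRadius t i ≤ 7 * (20 * t) ^ i := by
  induction i with
  | zero => simp [coverRadius]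
  | succ i ih =>
    rw [coverRadius, pow_succ]
    generalize (20 * t) ^ i = a at *
    generalize coverRadius t i = g at *
    have h1 : t * (5 * g) ≤ t * (7 * a) := Nat.mul_le_mul_left t ih
    have h2 : 6 * a ≤ t * a := Nat.mul_le_mul_right a ht
    nlinarith

/-- One scale of the stretch argument. Here `g` bounds the distance to the centres `S` of the
current level, and `S'` are the centres of the next level. -/
theorem Within.stretch_or_near {G H : SimpleGraph V} (hHG : H ≤ G) {S S' : Set V}
    {a g t c : ℕ}
    (hforest : ∀ u, (∃ s ∈ S, G.Within u s g) → ∃ s ∈ S, H.Within u s g)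
    (hstep : ∀ s ∈ S, (∀ s' ∈ S, G.Within s s' (a + 2 * g) →
        H.Within s s' (2 * t * (a + 2 * g))) ∨ ∃ s' ∈ S', G.Within s s' (2 * t * (a + 2 * g)))
    (hc : 2 * g + 2 * t * (a + 2 * g) ≤ c) {p q : V} (hpq : G.Within p q a)
    (hp : ∃ s ∈ S, G.Within p s g) (hq : ∃ s ∈ S, G.Within q s g) :
    H.Within p q c ∨ (∃ s ∈ S', G.Within p s (g + 2 * t * (a + 2 * g))) ∧
      ∃ s ∈ S', G.Within q s (g + 2 * t * (a + 2 * g)) := by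
  obtain ⟨s, hs, hps⟩ := hforest p hp
  obtain ⟨s', hs', hqs⟩ := hforest q hq
  -- The forest may lead to another centre than the given one; its distance in `G` is recovered from
  -- `H ≤ G`.
  have hps' := hps.of_le hHG
  have hqs' := hqs.of_le hHG
  have hss : G.Within s s' (a + 2 * g) := ((hps'.symm.trans hpq).trans hqs').mono (by omega)
  rcases hstep s hs with h | ⟨z, hz, hsz⟩
  · exact Or.inl (((hps.trans (h s' hs' hss)).trans hqs.symm).mono (by omega))
  · rcases hstep s' hs' with h | ⟨z', hz', hsz'⟩
    · exact Or.inl (((hps.trans (h s hs hss.symm).symm).trans hqs.symm).mono (by omega))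
    · exact Or.inr ⟨⟨z, hz, hps'.trans hsz⟩, z', hz', hqs'.trans hsz'⟩

/-- The stretch argument across all scales. -/
theorem Within.stretch_of_hierarchy {G H : SimpleGraph V} (hHG : H ≤ G) {t α L : ℕ}
    (ht : 6 ≤ t) (hα : 38 * t + 14 ≤ 5 * α) (S : ℕ → Set V) (hS0 : ∀ u, u ∈ S 0)
    (hSL : ∀ u, u ∉ S (L + 1))
    (hforest : ∀ i ≤ L, ∀ u, (∃ s ∈ S i, G.Within u s (coverRadius t i)) →
      ∃ s ∈ S i, H.Within u s (coverRadius t i))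
    (hstep : ∀ i ≤ L, ∀ s ∈ S i,
      (∀ s' ∈ S i, G.Within s s' ((20 * t) ^ i + 2 * coverRadius t i) →
        H.Within s s' (2 * t * ((20 * t) ^ i + 2 * coverRadius t i))) ∨
      ∃ s' ∈ S (i + 1), G.Within s s' (2 * t * ((20 * t) ^ i + 2 * coverRadius t i)))
    {u v : V} {d : ℕ} (huv : G.Within u v d) :
    H.Within u v ((d / (20 * t) ^ L + 1) * (α * (20 * t) ^ L)) := by
  -- Since 5g ≤ 7a, five times the left side is at most (38t + 14)a; this is the origin of `hα`.
  have hc : ∀ i, 2 * coverRadius t i + 2 * t * ((20 * t) ^ i + 2 * coverRadius t i) ≤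
      α * (20 * t) ^ i := by
    intro i
    have h := five_mul_coverRadius_le ht i
    generalize (20 * t) ^ i = a at *
    generalize coverRadius t i = g at *
    have h1 : t * (5 * g) ≤ t * (7 * a) := Nat.mul_le_mul_left t h
    have h2 : (38 * t + 14) * a ≤ 5 * α * a := Nat.mul_le_mul_right a hα
    nlinarith
  have main : ∀ i ≤ L, ∀ p q, G.Within p q ((20 * t) ^ i) →
      H.Within p q (α * (20 * t) ^ i) ∨
      (∃ s ∈ S (i + 1), G.Within p s (coverRadius t i +
        2 * t * ((20 * t) ^ i + 2 * coverRadius t i))) ∧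
      ∃ s ∈ S (i + 1), G.Within q s (coverRadius t i +
        2 * t * ((20 * t) ^ i + 2 * coverRadius t i)) := by
    intro i
    induction i with
    | zero =>
      intro hi p q hpq
      exact hpq.stretch_or_near hHG (hforest 0 hi) (hstep 0 hi) (hc 0)
        ⟨p, hS0 p, Within.refl G p _⟩ ⟨q, hS0 q, Within.refl G q _⟩
    | succ i ih =>
      intro hi p q hpq
      have hpow : (20 * t) ^ (i + 1) = 20 * t * (20 * t) ^ i := pow_succ' _ _
      rcases Within.blocks (H := H) ((20 * t) ^ i) (α * (20 * t) ^ i) (20 * t)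
        (hpow ▸ hpq) with h | ⟨p', q', hp, hpq', hn, hq⟩
      · exact Or.inl (h.mono (by rw [hpow]; exact (Nat.mul_left_comm _ _ _).le))
      · rcases ih (by omega) p' q' hpq' with h | ⟨⟨s, hs, hps⟩, s', hs', hqs⟩
        · exact absurd h hn
        -- Both ends reach the bad block within (20t)^(i+1); adding the block's distance to the next
        -- centres gives exactly the next `coverRadius`.
        · refine hpq.stretch_or_near hHG (hforest _ hi) (hstep _ hi) (hc _)
            ⟨s, hs, ?_⟩ ⟨s', hs', ?_⟩
          · rw [coverRadius, hpow]
            exact hp.trans hps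
          · rw [coverRadius, hpow]
            exact hq.symm.trans hqs
  have hpos : 0 < (20 * t) ^ L := Nat.pow_pos (by omega)
  have hlen : d ≤ (d / (20 * t) ^ L + 1) * (20 * t) ^ L := by
    rw [mul_comm]
    exact (Nat.lt_mul_div_succ d hpos).le
  rcases Within.blocks (H := H) ((20 * t) ^ L) (α * (20 * t) ^ L) _ (huv.mono hlen) with
    h | ⟨p, q, -, hpq, hn, -⟩
  · exact h
  · rcases main L le_rfl p q hpq with h | ⟨⟨s, hs, -⟩, -⟩
    · exact absurd h hn
    · exact absurd hs (hSL s)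

end Hierarchy

/-! ### Assembling the spanner and counting its edges. -/

section Spanner

variable {V : Type*} [Fintype V]

/-- Iterated superclustering, starting from all vertices. -/
theorem exists_hierarchy (G : SimpleGraph V) {t : ℕ} (ht : 0 < t) (D : ℕ → ℕ) (Δ : ℕ → ℝ)
    (hΔ : ∀ i, 1 ≤ Δ i) :
    ∃ (S : ℕ → Finset V) (E : ℕ → Finset (Sym2 V)), S 0 = Finset.univ ∧ ∀ i,
      (E i : Set (Sym2 V)) ⊆ G.edgeSet ∧ ((E i).card : ℝ) ≤ Δ i * (S i).card * D i ∧
      ((S (i + 1)).card : ℝ) * Δ i ^ t ≤ (S i).card ∧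
      (((S i).card : ℝ) ≤ Δ i ^ t → S (i + 1) = ∅) ∧
      ∀ c ∈ S i, (∀ c' ∈ S i, G.Within c c' (D i) →
          (fromEdgeSet (E i : Set (Sym2 V))).Within c c' (2 * t * D i)) ∨
        ∃ s ∈ S (i + 1), G.Within c s (2 * t * D i) := by
  choose S' E h using fun (i : ℕ) (S : Finset V) => G.exists_supercluster ht S (D i) (hΔ i)
  let S : ℕ → Finset V := fun i => Nat.rec Finset.univ S' i
  exact ⟨S, fun i => E i (S i), rfl, fun i => h i (S i)⟩

theorem sum_pow_succ_le {b : ℕ} (hb : 2 ≤ b) (L : ℕ) :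
    ∑ i ∈ Finset.range (L + 1), b ^ i ≤ 2 * b ^ L := by
  induction L with
  | zero => simp
  | succ L ih =>
    rw [Finset.sum_range_succ, pow_succ]
    have : 2 * b ^ L ≤ b ^ L * b := by rw [mul_comm]; exact Nat.mul_le_mul_left _ hb
    omega

/-- The spanner, in terms of the number `t` of growth steps per scale and the number `L + 1` of
scales. -/
theorem exists_spanner (G : SimpleGraph V) {t α L k : ℕ} (ht : 6 ≤ t)
    (hα : 38 * t + 14 ≤ 5 * α) {x : ℝ} (hx : 1 ≤ x) (hxk : x ^ k = Fintype.card V)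
    (hL : k + 1 ≤ (t + 1) ^ (L + 1)) :
    ∃ E : Finset (Sym2 V), (E : Set (Sym2 V)) ⊆ G.edgeSet ∧
      (E.card : ℝ) ≤ 10 * ((20 * t : ℕ) ^ L : ℕ) * (Fintype.card V * x) ∧
      ∀ u v d, G.Within u v d → (fromEdgeSet (E : Set (Sym2 V))).Within u v
        ((d / (20 * t) ^ L + 1) * (α * (20 * t) ^ L)) := by
  classical
  set n : ℝ := (Fintype.card V : ℝ) with hn
  have hn0 : 0 ≤ n := Nat.cast_nonneg _
  have hx0 : 0 < x := by linarith
  let D : ℕ → ℕ := fun i => (20 * t) ^ i + 2 * coverRadius t i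
  obtain ⟨S, E, hS0, hSE⟩ := G.exists_hierarchy (t := t) (by omega) D
    (fun i => x ^ (t + 1) ^ i) fun i => one_le_pow₀ hx
  choose F hF hFcard hFnear using fun i => G.exists_bfs_forest (S i : Set V) (coverRadius t i)
  -- The growth factor rises by its own `t`-th power, exactly the factor by which the centres thin
  -- out.
  have hcard : ∀ i, x ^ (t + 1) ^ i * (S i).card ≤ n * x := by
    intro i
    induction i with
    | zero => simp [hS0, hn, mul_comm]
    | succ i ih =>
      calc x ^ (t + 1) ^ (i + 1) * (S (i + 1)).card
          = x ^ (t + 1) ^ i * ((S (i + 1)).card * (x ^ (t + 1) ^ i) ^ t) := by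
            rw [pow_succ (t + 1) i, pow_mul, pow_succ (x ^ (t + 1) ^ i) t]
            ring
        _ ≤ x ^ (t + 1) ^ i * (S i).card := by
            gcongr
            exact (hSE i).2.2.1
        _ ≤ n * x := ih
  have hSL : S (L + 1) = ∅ := by
    refine (hSE L).2.2.2.1 ?_
    -- The right side is x^((t+1)^(L+1)) ≥ x^(k+1) = nx; the extra 1 in `hL` pays for the factor x.
    have h1 : n * x ≤ x ^ (t + 1) ^ L * (x ^ (t + 1) ^ L) ^ t := by
      rw [← pow_succ', ← pow_mul, ← pow_succ, ← hxk, ← pow_succ]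
      exact pow_le_pow_right₀ hx hL
    exact le_of_mul_le_mul_left ((hcard L).trans h1) (by positivity)
  let U : Finset (Sym2 V) := (Finset.range (L + 1)).biUnion fun i => E i ∪ F i
  have hsubE : ∀ i ≤ L, E i ⊆ U := fun i hi => Finset.subset_union_left.trans
    (Finset.subset_biUnion_of_mem (fun i => E i ∪ F i) (Finset.mem_range.mpr (by omega)))
  have hsubF : ∀ i ≤ L, F i ⊆ U := fun i hi => Finset.subset_union_right.trans
    (Finset.subset_biUnion_of_mem (fun i => E i ∪ F i) (Finset.mem_range.mpr (by omega)))
  have hUG : (U : Set (Sym2 V)) ⊆ G.edgeSet := by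
    intro e he
    simp only [U, Finset.coe_biUnion, Set.mem_iUnion, Finset.coe_union] at he
    obtain ⟨i, -, h⟩ := he
    exact h.elim (fun h => (hSE i).1 h) fun h => hF i h
  refine ⟨U, hUG, ?_, ?_⟩
  · have hterm : ∀ i, ((E i ∪ F i).card : ℝ) ≤ 5 * ((20 * t : ℕ) ^ i : ℕ) * (n * x) := by
      intro i
      have h1 : ((E i ∪ F i).card : ℝ) ≤ (E i).card + (F i).card := by
        exact_mod_cast Finset.card_union_le _ _
      have h2 : ((E i).card : ℝ) ≤ n * x * D i :=
        (hSE i).2.1.trans (mul_le_mul_of_nonneg_right (hcard i) (Nat.cast_nonneg _))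
      have h3 : ((F i).card : ℝ) ≤ n * x := by
        have h : ((F i).card : ℝ) ≤ n := by
          rw [hn]
          exact_mod_cast (hFcard i).trans (Finset.card_le_univ _)
        nlinarith
      have h4 : (D i : ℝ) + 1 ≤ 5 * ((20 * t : ℕ) ^ i : ℕ) := by
        have hg := five_mul_coverRadius_le ht i
        have hpos : 0 < (20 * t) ^ i := Nat.pow_pos (by omega)
        have : D i + 1 ≤ 5 * (20 * t) ^ i := by
          simp only [D]
          omega
        exact_mod_cast this
      calc ((E i ∪ F i).card : ℝ) ≤ (D i + 1) * (n * x) := by linarith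
        _ ≤ _ := by gcongr
    calc (U.card : ℝ) ≤ ∑ i ∈ Finset.range (L + 1), ((E i ∪ F i).card : ℝ) := by
          exact_mod_cast Finset.card_biUnion_le
      _ ≤ ∑ i ∈ Finset.range (L + 1), 5 * ((20 * t : ℕ) ^ i : ℕ) * (n * x) :=
          Finset.sum_le_sum fun i _ => hterm i
      _ = 5 * ((∑ i ∈ Finset.range (L + 1), (20 * t) ^ i : ℕ) : ℝ) * (n * x) := by
          rw [Nat.cast_sum, Finset.mul_sum, Finset.sum_mul]
      _ ≤ 5 * ((2 * (20 * t) ^ L : ℕ) : ℝ) * (n * x) := by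
          gcongr
          exact sum_pow_succ_le (by omega) L
      _ = _ := by
          push_cast
          ring
  · intro u v d huv
    refine huv.stretch_of_hierarchy ?_ ht hα (fun i => (S i : Set V)) (by simp [hS0])
      (by simp [hSL]) ?_ ?_
    · rw [← fromEdgeSet_edgeSet G]
      exact fromEdgeSet_mono hUG
    · intro i hi u hu
      obtain ⟨s, hs, h⟩ := hFnear i _ le_rfl u hu
      exact ⟨s, hs, h.of_le (fromEdgeSet_mono (Finset.coe_subset.mpr (hsubF i hi)))⟩
    · intro i hi s hs
      rcases (hSE i).2.2.2.2 s hs with h | h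
      · exact Or.inl fun s' hs' hss' => (h s' hs' hss').of_le
          (fromEdgeSet_mono (Finset.coe_subset.mpr (hsubE i hi)))
      · exact Or.inr h

end Spanner

end SimpleGraph

/-! ### Choice of parameters and conclusion. -/

theorem SimpleGraph.isAddMulSpanner_of_within {V : Type*} {G H : SimpleGraph V} (hHG : H ≤ G)
    {a α : ℕ} {A B : ℝ} (hA : (α : ℝ) ≤ A) (hB : (α * a : ℝ) ≤ B)
    (h : ∀ u v d, G.Within u v d → H.Within u v ((d / a + 1) * (α * a))) :
    IsAddMulSpanner G H A B := by
  refine ⟨hHG, fun u v huv => ?_⟩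
  obtain ⟨p, hp⟩ := huv.exists_walk_length_eq_dist
  obtain ⟨q, hq⟩ := h u v _ ⟨p, hp.le⟩
  refine ⟨q.reachable, ?_⟩
  have h1 : H.dist u v ≤ α * (G.dist u v) + α * a := by
    refine (dist_le q).trans (hq.trans ?_)
    have h2 : G.dist u v / a * a ≤ G.dist u v := Nat.div_mul_le_self _ _
    -- Whole blocks give the multiplicative part; the one rounding block is the additive part.
    calc (G.dist u v / a + 1) * (α * a) = α * (G.dist u v / a * a) + α * a := by ring
      _ ≤ _ := by gcongr
  calc (H.dist u v : ℝ) ≤ α * (G.dist u v) + α * a := by exact_mod_cast h1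
    _ ≤ _ := by gcongr

theorem expectedSize_pure {V : Type*} (H : SimpleGraph V) :
    expectedSize (PMF.pure H) = (H.edgeSet.encard : ℝ≥0∞) := by
  rw [expectedSize, tsum_eq_single H]
  · simp
  · intro H' hH'
    simp [PMF.pure_apply, hH']

/-- Choice of the number of growth steps per scale, the number of scales and the stretch. -/
theorem exists_spanner_parameters {ε : ℝ} {k : ℕ} (hε : 0 < ε) (hε2 : ε < 1 / 2)
    (hk : (16 : ℝ) ^ (1 / ε) ≤ k) :
    ∃ t α L : ℕ, 6 ≤ t ∧ 38 * t + 14 ≤ 5 * α ∧ k + 1 ≤ (t + 1) ^ (L + 1) ∧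
      (α : ℝ) ≤ 8 * (k : ℝ) ^ ε ∧
      (α : ℝ) * ((20 * t : ℕ) ^ L : ℕ) ≤ (64 : ℝ) ^ (1 / ε) * k := by
  have hinv : 2 < 1 / ε := by rw [lt_div_iff₀ hε]; linarith
  have hk1 : (1 : ℝ) ≤ k := (Real.one_le_rpow (by norm_num) (by positivity)).trans hk
  have hk0 : (0 : ℝ) < k := by linarith
  obtain ⟨L, hL⟩ : ∃ L, ⌈1 / ε⌉₊ = L + 1 :=
    ⟨⌈1 / ε⌉₊ - 1, by have := Nat.ceil_pos.mpr (show 0 < 1 / ε by linarith); omega⟩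
  have hLle : 1 / ε ≤ (L + 1 : ℕ) := hL ▸ Nat.le_ceil _
  have hLlt : (L : ℝ) < 1 / ε := by
    have := Nat.ceil_lt_add_one (show 0 ≤ 1 / ε by linarith)
    rw [hL] at this
    push_cast at this
    linarith
  have hL0 : (0 : ℝ) < (L + 1 : ℕ) := by positivity
  set y : ℝ := (k : ℝ) ^ (1 / ((L + 1 : ℕ) : ℝ)) with hy
  have hy0 : 0 ≤ y := by positivity
  have hyL : y ^ (L + 1) = k := by
    rw [hy, one_div]
    exact Real.rpow_inv_natCast_pow hk0.le (Nat.succ_ne_zero L)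
  have hT : (16 : ℝ) ≤ (k : ℝ) ^ ε := by
    calc (16 : ℝ) = ((16 : ℝ) ^ (1 / ε)) ^ ε := by
          rw [← Real.rpow_mul (by norm_num), one_div_mul_cancel hε.ne', Real.rpow_one]
      _ ≤ _ := by gcongr
  have hyT : y ≤ (k : ℝ) ^ ε := by
    refine Real.rpow_le_rpow_of_exponent_le hk1 ?_
    rw [div_le_iff₀ hL0]
    rw [div_le_iff₀ hε] at hLle
    linarith
  have hy6 : (6 : ℝ) ≤ y := by
    -- From L < 1/ε and ε < 1/2 follows 2ε(L + 1) < 3, so y³ ≥ k^(2ε) ≥ 256 > 216.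
    have h1 : (6 : ℝ) ^ 3 ≤ y ^ 3 := by
      calc (6 : ℝ) ^ 3 ≤ 16 ^ (2 : ℝ) := by norm_num
        _ ≤ ((k : ℝ) ^ ε) ^ (2 : ℝ) := by gcongr
        _ = (k : ℝ) ^ (ε * 2) := (Real.rpow_mul hk0.le _ _).symm
        _ ≤ (k : ℝ) ^ (1 / ((L + 1 : ℕ) : ℝ) * (3 : ℕ)) := by
            refine Real.rpow_le_rpow_of_exponent_le hk1 ?_
            rw [one_div_mul_eq_div, le_div_iff₀ hL0]
            push_cast
            have h2 : ε * L < 1 := by rw [lt_div_iff₀ hε] at hLlt; linarith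
            linarith
        _ = y ^ 3 := by rw [Real.rpow_mul hk0.le, Real.rpow_natCast]
    exact le_of_pow_le_pow_left₀ (by norm_num) hy0 h1
  set t := ⌊y⌋₊ with ht
  have ht6 : 6 ≤ t := Nat.le_floor (by exact_mod_cast hy6)
  have hty : (t : ℝ) ≤ y := Nat.floor_le hy0
  -- 8t satisfies the condition on `α` except at t = 6; 57 repairs that case and stays below both
  -- 10t and 8 · 16 ≤ 8k^ε.
  refine ⟨t, max (8 * t) 57, L, ht6, by omega, ?_, ?_, ?_⟩
  · have h1 : (k : ℝ) < ((t + 1 : ℕ) : ℝ) ^ (L + 1) := by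
      rw [← hyL]
      gcongr
      push_cast
      exact Nat.lt_floor_add_one y
    exact_mod_cast h1
  · push_cast
    exact max_le (by linarith) (by linarith)
  · have hα : (max (8 * t) 57 : ℕ) ≤ 10 * t := by omega
    calc ((max (8 * t) 57 : ℕ) : ℝ) * ((20 * t : ℕ) ^ L : ℕ)
        ≤ ((10 * t : ℕ) : ℝ) * ((20 * t : ℕ) ^ L : ℕ) := by gcongr
      _ = 10 * 20 ^ L * (t : ℝ) ^ (L + 1) := by
          push_cast
          ring
      -- The base 64 splits as 3.2 · 20, and 10 ≤ 3.2² is absorbed because 1/ε > 2.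
      _ ≤ (3.2 : ℝ) ^ (1 / ε) * 20 ^ (1 / ε) * k := by
          gcongr
          · calc (10 : ℝ) ≤ 3.2 ^ (2 : ℝ) := by norm_num
              _ ≤ _ := Real.rpow_le_rpow_of_exponent_le (by norm_num) hinv.le
          · rw [← Real.rpow_natCast]
            exact Real.rpow_le_rpow_of_exponent_le (by norm_num) hLlt.le
          · rw [← hyL]
            gcongr
      _ = _ := by
          rw [← Real.mul_rpow (by norm_num) (by norm_num)]
          norm_num

theorem theorem3 :
    ∃ C : ℝ, 0 < C ∧
      ∀ (V : Type*) [Fintype V] (G : SimpleGraph V) (ε : ℝ) (k : ℕ),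
        0 < ε → ε < 1 / 2 → (16 : ℝ) ^ (1 / ε) ≤ (k : ℝ) →
        ∃ μ : PMF (SimpleGraph V),
          (∀ H ∈ μ.support,
            IsAddMulSpanner G H (8 * (k : ℝ) ^ ε) ((64 : ℝ) ^ (1 / ε) * (k : ℝ))) ∧
          expectedSize μ ≤ ENNReal.ofReal
            (C * ((64 : ℝ) ^ (1 / ε) * (k : ℝ)
                    * (Fintype.card V : ℝ) ^ (1 + 1 / (k : ℝ))
                + (64 : ℝ) ^ (2 / ε) * (k : ℝ) ^ 2 * (Fintype.card V : ℝ))) := by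
  refine ⟨10, by norm_num, fun V _ G ε k hε hε2 hk => ?_⟩
  -- A single spanner is small enough, so the distribution may be a point mass.
  suffices h : ∃ E : Finset (Sym2 V), IsAddMulSpanner G
      (SimpleGraph.fromEdgeSet (E : Set (Sym2 V))) (8 * (k : ℝ) ^ ε)
      ((64 : ℝ) ^ (1 / ε) * k) ∧
      (E.card : ℝ) ≤ 10 * ((64 : ℝ) ^ (1 / ε) * k * (Fintype.card V : ℝ) ^ (1 + 1 / (k : ℝ))) by
    obtain ⟨E, hE, hcard⟩ := h
    refine ⟨PMF.pure (SimpleGraph.fromEdgeSet (E : Set (Sym2 V))), fun H hH => ?_, ?_⟩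
    · rw [PMF.support_pure, Set.mem_singleton_iff] at hH
      exact hH ▸ hE
    · rw [expectedSize_pure]
      have h1 : (SimpleGraph.fromEdgeSet (E : Set (Sym2 V))).edgeSet.encard ≤ (E.card : ℕ∞) := by
        rw [← Set.encard_coe_eq_coe_finsetCard, SimpleGraph.edgeSet_fromEdgeSet]
        exact Set.encard_le_encard Set.sdiff_subset
      calc ((SimpleGraph.fromEdgeSet (E : Set (Sym2 V))).edgeSet.encard : ℝ≥0∞)
          ≤ (E.card : ℝ≥0∞) := by exact_mod_cast ENat.toENNReal_le.mpr h1
        _ = ENNReal.ofReal E.card := (ENNReal.ofReal_natCast _).symm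
        _ ≤ _ := by
          refine ENNReal.ofReal_le_ofReal (hcard.trans ?_)
          gcongr
          exact le_add_of_nonneg_right (by positivity)
  obtain ⟨t, α, L, ht, hα, hL, hα8, hαk⟩ := exists_spanner_parameters hε hε2 hk
  have hk0 : k ≠ 0 := by
    rintro rfl
    have : (0 : ℝ) < 16 ^ (1 / ε) := by positivity
    rw [Nat.cast_zero] at hk
    linarith
  -- For empty `V` the root n^(1/k) is 0, violating the requirement `1 ≤ x`.
  rcases isEmpty_or_nonempty V with hV | hV
  · refine ⟨∅, ⟨fun u => hV.elim u, fun u => hV.elim u⟩, ?_⟩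
    rw [Finset.card_empty, Nat.cast_zero]
    positivity
  have hn : (1 : ℝ) ≤ Fintype.card V := by exact_mod_cast Fintype.card_pos (α := V)
  obtain ⟨E, hEG, hcard, hspan⟩ := G.exists_spanner (k := k)
    (x := (Fintype.card V : ℝ) ^ (1 / (k : ℝ))) ht hα
    (Real.one_le_rpow hn (by positivity))
    (by rw [one_div]; exact Real.rpow_inv_natCast_pow (by positivity) hk0) hL
  refine ⟨E, ?_, ?_⟩
  · refine SimpleGraph.isAddMulSpanner_of_within ?_ hα8 hαk hspan
    rw [← SimpleGraph.fromEdgeSet_edgeSet G]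
    exact SimpleGraph.fromEdgeSet_mono hEG
  · rw [Real.rpow_add (by linarith), Real.rpow_one]
    have hα1 : (1 : ℝ) ≤ α := by exact_mod_cast (by omega : 1 ≤ α)
    have hB : (((20 * t : ℕ) ^ L : ℕ) : ℝ) ≤ (64 : ℝ) ^ (1 / ε) * k :=
      (le_mul_of_one_le_left (Nat.cast_nonneg _) hα1).trans hαk
    refine hcard.trans ?_
    rw [mul_assoc]
    gcongr
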